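/- Let $R$ be a complete valuation ring that is not a field: a valuation ring with fraction field $K$ such that $K^\times/R^\times$ is isomorphic to an ordered subgroup of $\mathbb R$ and $R$ is complete for the induced norm. Let $|\cdot|$ be the induced absolute value on $K$ (so $R=\{a\in K:|a|\le 1\}$), let $F$ be the residue field of $R$ with its trivial absolute value, $Q:R\to F$ the quotient map, and suppose that $K$ is algebraically closed. Fix a set $\tilde F\subseteq R$ containing $0$ that $Q$ maps bijectively onto $F$. For a commutative unital normed ring $S$, let $\mathbb A^1_S$ be the set of non-zero multiplicative seminorms $\lambda=|\cdot|_\lambda$ on $S[t]$ whose restriction to $S$ is contractive ($|a|_\lambda\le\|a\|$ for $a\in S$), with the topology of pointwise convergence. For $x\in F$ and $\tau\ge 0$ let $\zeta_{x,\tau}\in\mathbb A^1_F$ be the seminorm $\left|\sum_k a_k(t-x)^k\right|_{\zeta_{x,\tau}}=\max_{k:\,a_k\ne 0}\tau^k$ (where $0^0=1$, and the value is $0$ for the zero polynomial). Let $Q^{\mathbb A}:\mathbb A^1_F\to\mathbb A^1_R$ be composition with the coefficientwise reduction $R[t]\to F[t]$. For $\omega\in[1,\infty)$ let $K^\omega$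 be $K$ with the absolute value $|\cdot|^\omega$, let $J_\omega:\mathbb A^1_{K^\omega}\to\mathbb A^1_R$ be restriction to $R[t]$, and for $\lambda\in\mathbb A^1_K$ let $\lambda^\omega\in\mathbb A^1_{K^\omega}$ be $|p|_{\lambda^\omega}=|p|_\lambda^\omega$. Let $\Lambda:\mathbb A^1_K\times[1,\infty)\to\mathbb A^1_R$, $\Lambda(\lambda,\omega)=J_\omega(\lambda^\omega)$. Then: (a) $Q^{\mathbb A}$ is a homeomorphism of $\mathbb A^1_F$ onto a closed subset of $\mathbb A^1_R$. (b) $\Lambda$ is a homeomorphism of $\mathbb A^1_K\times[1,\infty)$ onto $\bigcup_{\omega\in[1,\infty)}J_\omega(\mathbb A^1_{K^\omega})$ (with the subspace topology). (c) Let $(\lambda_i,\omega_i)_{i\in I}$ be a net in $\mathbb A^1_K\times[1,\infty)$ and $\lambda_0\in\mathbb A^1_F$. Then $\Lambda(\lambda_i,\omega_i)\to Q^{\mathbb A}(\lambda_0)$ if and only if $\omega_i\to\infty$ and at least one of the following holds: - (C1) there are $\tau_1\in[0,1)$ and $b\in R$ with $|t-b|_{\lambda_i}^{\omega_i}\to\tau_1$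 and $\lambda_0=\zeta_{Q(b),\tau_1}$; - (C2) there is $\tau_2\in(1,\infty)$ with $|t|_{\lambda_i}^{\omega_i}\to\tau_2$ and $\lambda_0=\zeta_{0,\tau_2}$; - (C3) $|t-c|_{\lambda_i}^{\omega_i}\to 1$ for every $c\in\tilde F$, and $\lambda_0=\zeta_{0,1}$. (d) The image of $\Lambda$ is open and dense in $\mathbb A^1_R$. Moreover, identifying $r\in K$ with the seminorm $p\mapsto|p(r)|$ in $\mathbb A^1_K$, the set $\Lambda(K\times(1,\infty))$ is dense in $\mathbb A^1_R$. -/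

import Mathlib

open Polynomial Filter Topology
open scoped NNReal

noncomputable section

namespace BerkovichLine

/-- The one-dimensional affine analytic space over a commutative ring `S` with norm `nrm`: the
non-zero multiplicative seminorms on `S[t]` whose restriction to `S` is contractive. (A
multiplicative seminorm `μ` is non-zero if and only if `μ 1 = 1`, which is part of
`MulRingSeminorm`.) -/
structure AffineLine (S : Type*) [CommRing S] (nrm : S → ℝ) extends MulRingSeminorm S[X] where
  contractive' : ∀ a : S, toFun (C a) ≤ nrm a

namespace AffineLine

variable {S : Type*} [CommRing S] {nrm : S → ℝ}

instance instFunLike : FunLike (AffineLine S nrm) S[X] ℝ where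
  coe μ := μ.toMulRingSeminorm
  coe_injective μ ν h := by
    cases μ; cases ν; congr; exact DFunLike.coe_injective h

/-- The topology of pointwise convergence. -/
instance instTopologicalSpace : TopologicalSpace (AffineLine S nrm) :=
  TopologicalSpace.induced (fun μ (p : S[X]) => μ p) inferInstance

instance instMulRingSeminormClass : MulRingSeminormClass (AffineLine S nrm) S[X] ℝ where
  map_add_le_add μ := map_add_le_add μ.toMulRingSeminorm
  map_zero μ := map_zero μ.toMulRingSeminorm
  map_neg_eq_map μ := map_neg_eq_map μ.toMulRingSeminorm
  map_mul μ := map_mul μ.toMulRingSeminorm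
  map_one μ := map_one μ.toMulRingSeminorm

theorem contractive (μ : AffineLine S nrm) (a : S) : μ (C a) ≤ nrm a := μ.contractive' a

/-- A contractive ring homomorphism `f : S → T` induces the map sending a seminorm `μ` on `T[t]`
to the seminorm `p ↦ μ (f p)` on `S[t]`. -/
def comap {T : Type*} [CommRing T] {nrmT : T → ℝ} (f : S →+* T)
    (hf : ∀ a, nrmT (f a) ≤ nrm a) (μ : AffineLine T nrmT) : AffineLine S nrm where
  toFun p := μ (p.map f)
  map_zero' := by simp
  add_le' p q := by simpa using map_add_le_add μ (p.map f) (q.map f)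
  neg' p := by simp
  map_one' := by simp
  map_mul' p q := by simp
  contractive' a := by simpa using (μ.contractive (f a)).trans (hf a)

/-- If the absolute value `v` on a ring is non-Archimedean, then so is every point of the affine
line. -/
theorem isNonarchimedean {v : AbsoluteValue S ℝ} (hv : IsNonarchimedean v)
    (μ : AffineLine S v) : IsNonarchimedean μ := by
  intro x y
  by_contra! h
  set M := max (μ x) (μ y) with hM
  have hM0 : 0 ≤ M := (apply_nonneg μ x).trans (le_max_left _ _)
  have hnat : ∀ n : ℕ, μ (n : S[X]) ≤ 1 := fun n => by
    rcases subsingleton_or_nontrivial S with hS | hS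
    · rw [Subsingleton.elim (n : S[X]) 0, map_zero]; exact zero_le_one
    · rw [← C_eq_natCast]
      exact (μ.contractive _).trans hv.apply_natCast_le_one
  have key : ∀ n : ℕ, μ (x + y) ^ n ≤ (n + 1) * M ^ n := fun n => by
    have hsum : ∀ s : Finset ℕ, ∀ g : ℕ → S[X], μ (∑ i ∈ s, g i) ≤ ∑ i ∈ s, μ (g i) := by
      intro s g
      exact Finset.le_sum_of_subadditive μ (map_zero μ).le (map_add_le_add μ) s g
    rw [← map_pow, add_pow]
    refine (hsum _ _).trans ?_
    have : ∀ k ∈ Finset.range (n + 1),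
        μ (x ^ k * y ^ (n - k) * (n.choose k : S[X])) ≤ M ^ n := by
      intro k hk
      have hk' : k + (n - k) = n := by have := Finset.mem_range.1 hk; omega
      rw [map_mul, map_mul, map_pow, map_pow]
      calc μ x ^ k * μ y ^ (n - k) * μ (n.choose k : S[X])
          ≤ M ^ k * M ^ (n - k) * 1 := by
            have h1 : μ x ^ k ≤ M ^ k := pow_le_pow_left₀ (apply_nonneg μ x) (le_max_left _ _) _
            have h2 : μ y ^ (n - k) ≤ M ^ (n - k) :=
              pow_le_pow_left₀ (apply_nonneg μ y) (le_max_right _ _) _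
            have h3 := hnat (n.choose k)
            have h4 := apply_nonneg μ x
            have h5 := apply_nonneg μ y
            have h6 := apply_nonneg μ (n.choose k : S[X])
            gcongr
        _ = M ^ n := by rw [mul_one, ← pow_add, hk']
    refine (Finset.sum_le_sum this).trans ?_
    simp
  rcases hM0.eq_or_lt with h0 | hpos
  · have := key 1
    rw [← h0] at this h
    simp at this
    linarith
  · have hr : 1 < μ (x + y) / M := (one_lt_div hpos).2 h
    have hlim := tendsto_pow_const_div_const_pow_of_one_lt 1 hr
    have hlim0 := tendsto_pow_const_div_const_pow_of_one_lt 0 hr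
    have hadd := hlim.add hlim0
    rw [add_zero] at hadd
    have hev := hadd.eventually (gt_mem_nhds (show (0 : ℝ) < 1 by norm_num))
    obtain ⟨n, hn⟩ := hev.exists
    have hrn : 0 < (μ (x + y) / M) ^ n := pow_pos (by linarith) n
    rw [← add_div, div_lt_one hrn, div_pow, lt_div_iff₀ (pow_pos hpos n), pow_one, pow_zero] at hn
    exact absurd hn (not_lt.2 (key n))

/-- For `ω ≥ 1`, the point `λ ^ ω : p ↦ (λ p) ^ ω` of the affine line over the field (or ring) with
the absolute value `v ^ ω`. -/
def rpow {v : AbsoluteValue S ℝ} (hv : IsNonarchimedean v) (μ : AffineLine S v)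
    (ω : Set.Ici (1 : ℝ)) : AffineLine S (fun a => v a ^ (ω : ℝ)) where
  toFun p := μ p ^ (ω : ℝ)
  map_zero' := by
    rw [map_zero]; exact Real.zero_rpow (by have := ω.2; simp only [Set.mem_Ici] at this; linarith)
  add_le' p q := by
    have hω : (0 : ℝ) ≤ ω := zero_le_one.trans ω.2
    have h1 := apply_nonneg μ p
    have h2 := apply_nonneg μ q
    have h3 := Real.rpow_nonneg h1 ω
    have h4 := Real.rpow_nonneg h2 ω
    refine (Real.rpow_le_rpow (apply_nonneg μ _) (μ.isNonarchimedean hv p q) hω).trans ?_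
    rcases max_cases (μ p) (μ q) with ⟨h, -⟩ | ⟨h, -⟩ <;> rw [h] <;> linarith
  neg' p := by rw [map_neg_eq_map]
  map_one' := by simp
  map_mul' p q := by rw [map_mul, Real.mul_rpow (apply_nonneg μ p) (apply_nonneg μ q)]
  contractive' a :=
    Real.rpow_le_rpow (apply_nonneg μ _) (μ.contractive a) (zero_le_one.trans ω.2)

/-- The point `ζ_{s,τ}`, given by `|∑ aₖ (t - s) ^ k| = max |aₖ| τ ^ k` with `0 ^ 0 = 1`. Here
`taylor s p` is the polynomial `p (t + s)`, whose coefficients are the `aₖ`. -/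
def zeta [Nontrivial S] {v : AbsoluteValue S ℝ} (hv : IsNonarchimedean v) (s : S) (τ : ℝ≥0) :
    AffineLine S v where
  toFun p := (taylor s p).gaussNorm v (τ : ℝ)
  map_zero' := by simp
  add_le' p q := by
    rw [map_add]
    exact (isNonarchimedean_gaussNorm v hv τ.2).add_le (fun r => gaussNorm_nonneg v r τ.2)
  neg' p := by
    have : ∀ r : S[X], (-r).gaussNorm v (τ : ℝ) = r.gaussNorm v (τ : ℝ) := fun r => by
      simp only [gaussNorm, support_neg, coeff_neg, v.map_neg]
    rw [map_neg, this]
  map_one' := by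
    rw [taylor_one, gaussNorm_C, v.map_one]
  map_mul' p q := by
    rw [taylor_mul]
    rcases τ.2.eq_or_lt with h | h
    · have h' : (τ : ℝ) = 0 := h.symm
      simp [h', mul_coeff_zero]
    · exact gaussNorm_mul hv h _ _
  contractive' a := by simp

end AffineLine

section TrivialNorm

open Classical in
/-- The trivial absolute value of a field. -/
def trivialAbs (k : Type*) [Field k] : AbsoluteValue k ℝ := AbsoluteValue.trivial

theorem trivialAbs_le_one {k : Type*} [Field k] (x : k) : trivialAbs k x ≤ 1 := by
  by_cases hx : x = 0
  · simp [hx]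
  · classical exact (AbsoluteValue.trivial_apply hx).le

theorem isNonarchimedean_trivialAbs (k : Type*) [Field k] : IsNonarchimedean (trivialAbs k) := by
  intro x y
  by_cases hx : x = 0
  · simp [hx]
  · have : trivialAbs k x = 1 := by
      classical exact AbsoluteValue.trivial_apply hx
    rw [this]
    exact (trivialAbs_le_one _).trans (le_max_left _ _)

end TrivialNorm

section ValuationRing

variable {R K : Type*} [CommRing R] [IsDomain R] [ValuationRing R] [Field K] [Algebra R K]
  [IsFractionRing R K]

/-- The absolute value on the fraction field `K` of a valuation ring `R` that is induced by the
canonical valuation with values in `K ˣ / R ˣ` (together with `0`) and an order embedding `e` of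
`K ˣ / R ˣ` into the ordered group of positive real numbers. -/
def fieldAbs (e : ValuationRing.ValueGroup R K →*₀ ℝ≥0) (he : StrictMono e) :
    AbsoluteValue K ℝ where
  toFun x := e (ValuationRing.valuation R K x)
  map_mul' x y := by simp
  nonneg' x := NNReal.coe_nonneg _
  eq_zero' x := by simp
  add_le' x y := by
    have h := he.monotone ((ValuationRing.valuation R K).map_add x y)
    rw [he.monotone.map_max] at h
    exact_mod_cast h.trans (max_le (le_add_of_nonneg_right zero_le) (le_add_of_nonneg_left zero_le))

variable (e : ValuationRing.ValueGroup R K →*₀ ℝ≥0) (he : StrictMono e)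

/-- The restriction to `R` of the absolute value of `K`. -/
def ringAbs : AbsoluteValue R ℝ :=
  (fieldAbs e he).comp (IsFractionRing.injective R K)

theorem isNonarchimedean_fieldAbs : IsNonarchimedean (fieldAbs e he) := by
  intro x y
  have h := he.monotone ((ValuationRing.valuation R K).map_add x y)
  rw [he.monotone.map_max] at h
  exact_mod_cast h

theorem ringAbs_le_one (a : R) : ringAbs e he a ≤ 1 := by
  have h : ValuationRing.valuation R K (algebraMap R K a) ≤ 1 :=
    (ValuationRing.mem_integer_iff R K _).2 ⟨a, rfl⟩
  have := he.monotone h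
  rw [map_one] at this
  exact_mod_cast this

theorem trivialAbs_residue_le (a : R) :
    trivialAbs (IsLocalRing.ResidueField R) (IsLocalRing.residue R a) ≤ ringAbs e he a := by
  by_cases ha : IsLocalRing.residue R a = 0
  · rw [ha, map_zero]; exact (ringAbs e he).nonneg a
  · refine (trivialAbs_le_one _).trans ?_
    obtain ⟨u, rfl⟩ := (IsLocalRing.residue_ne_zero_iff_isUnit a).1 ha
    have h1 := ringAbs_le_one e he ((u⁻¹ : Rˣ) : R)
    have h2 : ringAbs e he (u : R) * ringAbs e he ((u⁻¹ : Rˣ) : R) = 1 := by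
      rw [← map_mul, Units.mul_inv, map_one]
    have h3 := (ringAbs e he).nonneg (u : R)
    nlinarith

/-- The space of the residue field, with its trivial absolute value, mapped into that of `R` through
the quotient map `R → F`. -/
def resMap : AffineLine (IsLocalRing.ResidueField R) (trivialAbs (IsLocalRing.ResidueField R)) →
    AffineLine R (ringAbs e he) :=
  AffineLine.comap (IsLocalRing.residue R) (trivialAbs_residue_le e he)

/-- For `ω ≥ 1`, the map `J_ω` restricting to `R[t]` the seminorms on `K[t]` that are contractive on
`K` with the absolute value `|·| ^ ω`. -/
def powMap (ω : Set.Ici (1 : ℝ)) :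
    AffineLine K (fun a => fieldAbs e he a ^ (ω : ℝ)) → AffineLine R (ringAbs e he) :=
  AffineLine.comap (algebraMap R K) fun a =>
    Real.rpow_le_self_of_le_one ((ringAbs e he).nonneg a) (ringAbs_le_one e he a) ω.2

/-- The map `Λ : (λ, ω) ↦ J_ω (λ ^ ω)`. -/
def lambdaMap (x : AffineLine K (fieldAbs e he) × Set.Ici (1 : ℝ)) :
    AffineLine R (ringAbs e he) :=
  powMap e he x.2 (x.1.rpow (isNonarchimedean_fieldAbs e he) x.2)

/-- The point `ζ_{s,τ}` of the affine line over `K`. -/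
def zetaField (s : K) (τ : ℝ≥0) : AffineLine K (fieldAbs e he) :=
  AffineLine.zeta (isNonarchimedean_fieldAbs e he) s τ

variable (R) in
/-- The point `ζ_{x,τ}` of the affine line over the residue field. -/
def zetaRes (x : IsLocalRing.ResidueField R) (τ : ℝ≥0) :
    AffineLine (IsLocalRing.ResidueField R) (trivialAbs (IsLocalRing.ResidueField R)) :=
  AffineLine.zeta (isNonarchimedean_trivialAbs _) x τ

end ValuationRing

end BerkovichLine

end

/-!
Fix `ϖ ∈ R` with `0 < |ϖ| < 1`. A point of the affine line over `R` either vanishes on the whole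
maximal ideal or vanishes at no nonzero constant.

In the first case it factors through the polynomials over the residue field
(`mem_range_resMap_iff`). In the second case it extends to `K[t]` by taking fractions; the extension
restricts on `K` to an absolute value that is at most `|·|` on `R`, hence equals `|·| ^ ω` for some
`ω ≥ 1`, and its power with exponent `1 / ω` is a point over `K` because all seminorms involved are
non-Archimedean (`mem_range_lambdaMap_iff`). So the images of the two spaces are complementary, the
first one closed and the second one open. The exponent `ω = log |ϖ|_μ / log |ϖ|` and the values at
fractions depend continuously on the point `μ`, so `Λ` is an embedding (`isEmbedding_lambdaMap`).

For the convergence criterion, roots in the algebraically closed field `K` split every polynomial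
over `R` into constants, factors `t - a` with `a ∈ R`, and factors `b t - 1` with `b` in the maximal
ideal (`polynomial_induction_of_isAlgClosed`). As `ω → ∞`, the constants and the factors `b t - 1`
converge by themselves, so only the factors `t - a` matter (`tendsto_lambdaMap_of_X_sub_C`). The
same factorization shows that points over the residue field are determined by their values at the
`t - x`, hence are all of the form `ζ_{x,τ}` (`eq_zetaRes`), and the three kinds of such points give
the three cases.

Density of the image of `Λ` follows, as `Λ (ζ_{b, τ ^ (1 / n)}, n)` converges to the image of the
point `ζ_{x,τ}` for any lift `b` of `x`. Finally `K` is dense in the affine line over `K`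
(`dense_range_zetaField`): given finitely many `a`, choose among them `a₀` with the least value `d`
at `t - a₀`, and perturb `a₀` by an element of absolute value slightly above `d`.
-/

namespace BerkovichLine

/-! ### Points of the affine line -/

namespace AffineLine

variable {S : Type*} [CommRing S] {nrm : S → ℝ}

theorem tendsto_nhds_iff {ι : Type*} {f : Filter ι} {g : ι → AffineLine S nrm}
    {μ : AffineLine S nrm} :
    Tendsto g f (𝓝 μ) ↔ ∀ p, Tendsto (fun i => g i p) f (𝓝 (μ p)) := by
  rw [nhds_induced, tendsto_comap_iff, tendsto_pi_nhds]
  rfl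

theorem continuous_eval (p : S[X]) : Continuous fun μ : AffineLine S nrm => μ p :=
  (continuous_apply p).comp continuous_induced_dom

theorem continuous_iff {Y : Type*} [TopologicalSpace Y] {g : Y → AffineLine S nrm} :
    Continuous g ↔ ∀ p, Continuous fun y => g y p := by
  simp only [continuous_iff_continuousAt, ContinuousAt, tendsto_nhds_iff]
  exact forall_comm

/-- In an ultrametric sum of two terms of different size the larger one wins. -/
theorem add_eq_right_of_lt {α : Type*} [AddCommGroup α] {F : Type*} [FunLike F α ℝ]
    [AddGroupSeminormClass F α ℝ] {μ : F} (hμ : IsNonarchimedean μ) {p q : α} (h : μ p < μ q) :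
    μ (p + q) = μ q := by
  refine le_antisymm ((hμ p q).trans (max_le h.le le_rfl)) ?_
  have := hμ (p + q) (-p)
  rw [map_neg_eq_map, add_neg_cancel_comm] at this
  rcases le_max_iff.1 this with h1 | h1
  · exact h1
  · exact absurd h (not_lt.2 h1)

theorem gaussNorm_X_add_C [Nontrivial S] {v : AbsoluteValue S ℝ} (hv : IsNonarchimedean v) (a : S)
    {τ : ℝ} (hτ : 0 ≤ τ) : (X + C a).gaussNorm v τ = max τ (v a) := by
  refine le_antisymm ?_ (max_le ?_ ?_)
  · have h := isNonarchimedean_gaussNorm v hv hτ X (C a)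
    rwa [gaussNorm_C, ← monomial_one_one_eq_X, gaussNorm_monomial, v.map_one, pow_one, one_mul] at h
  · have h1 : (X + C a).coeff 1 = 1 := by rw [coeff_add, coeff_X_one, coeff_C_succ, add_zero]
    have h := le_gaussNorm v (X + C a) hτ 1
    rwa [h1, v.map_one, pow_one, one_mul] at h
  · have h0 : (X + C a).coeff 0 = a := by rw [coeff_add, coeff_X_zero, coeff_C_zero, zero_add]
    have h := le_gaussNorm v (X + C a) hτ 0
    rwa [h0, pow_zero, mul_one] at h

theorem zeta_X_sub_C [Nontrivial S] {v : AbsoluteValue S ℝ} (hv : IsNonarchimedean v) (s a : S)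
    (τ : ℝ≥0) : zeta hv s τ (X - C a) = max (τ : ℝ) (v (s - a)) := by
  have h : taylor s (X - C a) = X + C (s - a) := by
    rw [map_sub, taylor_X, taylor_C, C_sub]; ring
  change (taylor s (X - C a)).gaussNorm v (τ : ℝ) = _
  rw [h]
  exact gaussNorm_X_add_C hv _ τ.2

/-- Over a field, a point restricts to the given absolute value on constants. -/
theorem apply_C {k : Type*} [Field k] {v : AbsoluteValue k ℝ} (μ : AffineLine k v) (a : k) :
    μ (C a) = v a := by
  rcases eq_or_ne a 0 with rfl | ha
  · simp
  refine le_antisymm (μ.contractive a) ?_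
  have h1 : μ (C a) * μ (C a⁻¹) = 1 := by
    rw [← map_mul, ← C_mul, mul_inv_cancel₀ ha, C_1, map_one]
  have h2 : μ (C a⁻¹) ≤ (v a)⁻¹ := (μ.contractive a⁻¹).trans (map_inv₀ v a).le
  have h3 : 0 < v a := v.pos ha
  have h4 : μ (C a) * μ (C a⁻¹) ≤ μ (C a) * (v a)⁻¹ :=
    mul_le_mul_of_nonneg_left h2 (apply_nonneg μ _)
  rw [h1, ← div_eq_mul_inv, one_le_div h3] at h4
  exact h4

end AffineLine

/-! ### Valuation rings of rank one and factorization of polynomials over them -/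

/-- If `r = 1 / b` with `b ∈ R` is a root of a polynomial over `R`, then that polynomial is divisible
over `R` by `b t - 1`: the coefficients of the quotient over `K` are given by a recursion over `R`,
starting from the constant one. -/
theorem exists_eq_mul_of_isRoot_inv {R K : Type*} [CommRing R]
    [Field K] [Algebra R K] [IsFractionRing R K] {b : R} {r : K}
    (hbr : algebraMap R K b * r = 1) {p : R[X]} (hp : (p.map (algebraMap R K)).IsRoot r) :
    ∃ q : R[X], p = (C b * X - 1) * q := by
  obtain ⟨q₀, hq₀⟩ := dvd_iff_isRoot.2 hp
  have hb0 : algebraMap R K b ≠ 0 := left_ne_zero_of_mul_eq_one hbr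
  set q : K[X] := C (algebraMap R K b)⁻¹ * q₀ with hq
  have hpq : p.map (algebraMap R K) = (C (algebraMap R K b) * X - 1) * q := by
    have h1 : (C (algebraMap R K b) * X - 1 : K[X]) = C (algebraMap R K b) * (X - C r) := by
      rw [mul_sub, ← C_mul, hbr, C_1]
    have h2 : (C (algebraMap R K b) * C (algebraMap R K b)⁻¹ : K[X]) = 1 := by
      rw [← C_mul, mul_inv_cancel₀ hb0, C_1]
    rw [hq₀, h1, hq]
    linear_combination (-(X - C r) * q₀) * h2
  have hcoeff : ∀ n, q.coeff n ∈ Set.range (algebraMap R K) := by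
    intro n
    have hn := congrArg (fun f => coeff f n) hpq
    simp only [coeff_map, sub_mul, one_mul, coeff_sub, mul_assoc, coeff_C_mul] at hn
    induction n with
    | zero =>
      refine ⟨-p.coeff 0, ?_⟩
      rw [coeff_X_mul_zero] at hn
      rw [map_neg, hn]; ring
    | succ n ih =>
      have hn' := congrArg (fun f => coeff f n) hpq
      simp only [coeff_map, sub_mul, one_mul, coeff_sub, mul_assoc, coeff_C_mul] at hn'
      obtain ⟨c, hc⟩ := ih hn'
      rw [coeff_X_mul, ← hc] at hn
      refine ⟨b * c - p.coeff (n + 1), ?_⟩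
      rw [map_sub, map_mul, hn]; ring
  obtain ⟨q', hq'⟩ := (mem_lifts _).1 ((lifts_iff_coeff_lifts q).2 hcoeff)
  refine ⟨q', map_injective _ (IsFractionRing.injective R K) ?_⟩
  rw [hpq, ← hq']
  simp

section ValuationRing

variable {R K : Type*} [CommRing R] [IsDomain R] [ValuationRing R] [Field K] [Algebra R K]
  [IsFractionRing R K]
variable (e : ValuationRing.ValueGroup R K →*₀ ℝ≥0) (he : StrictMono e)

theorem ringAbs_apply (a : R) : ringAbs e he a = fieldAbs e he (algebraMap R K a) := rfl

theorem fieldAbs_le_one_iff (x : K) : fieldAbs e he x ≤ 1 ↔ ∃ a, algebraMap R K a = x := by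
  rw [← ValuationRing.mem_integer_iff R K x, Valuation.mem_integer_iff, ← he.le_iff_le, map_one]
  exact NNReal.coe_le_coe (r₂ := 1)

theorem ringAbs_eq_one_of_isUnit {a : R} (ha : IsUnit a) : ringAbs e he a = 1 := by
  refine le_antisymm (ringAbs_le_one e he a) ?_
  have h := trivialAbs_residue_le e he a
  classical
  rwa [trivialAbs, AbsoluteValue.trivial_apply
    ((IsLocalRing.residue_ne_zero_iff_isUnit a).2 ha)] at h

theorem isUnit_iff_ringAbs_eq_one {a : R} : IsUnit a ↔ ringAbs e he a = 1 := by
  refine ⟨ringAbs_eq_one_of_isUnit e he, fun h => ?_⟩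
  obtain ⟨b, hb⟩ := (fieldAbs_le_one_iff e he (algebraMap R K a)⁻¹).1
    (by rw [map_inv₀, ← ringAbs_apply, h, inv_one])
  have ha : algebraMap R K a ≠ 0 := by
    intro h0
    rw [ringAbs_apply, h0, map_zero] at h
    exact zero_ne_one h
  refine IsUnit.of_mul_eq_one b (IsFractionRing.injective R K ?_)
  rw [map_mul, hb, mul_inv_cancel₀ ha, map_one]

theorem ringAbs_lt_one_iff {a : R} : ringAbs e he a < 1 ↔ IsLocalRing.residue R a = 0 := by
  rw [← not_iff_not, ← ne_eq, IsLocalRing.residue_ne_zero_iff_isUnit,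
    isUnit_iff_ringAbs_eq_one e he, not_lt]
  exact ⟨fun h => le_antisymm (ringAbs_le_one e he a) h, fun h => h.ge⟩

/-- A valuation ring of rank one that is not a field has an element `ϖ` with `0 < |ϖ| < 1`. -/
theorem exists_ringAbs_lt_one (hR : ¬ IsField R) :
    ∃ ϖ : R, ϖ ≠ 0 ∧ ringAbs e he ϖ < 1 := by
  obtain ⟨a, ha, hu⟩ := Ring.exists_not_isUnit_of_not_isField hR
  exact ⟨a, ha, lt_of_le_of_ne (ringAbs_le_one e he a)
    (mt (isUnit_iff_ringAbs_eq_one e he).2 hu)⟩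

/-- If `K` is algebraically closed, then the values of `K` are dense in `[0, ∞)`: the roots of a
single element `ϖ` with `0 < |ϖ| < 1`, and their powers, have enough values. -/
theorem exists_fieldAbs_mem_Ioo [IsAlgClosed K] (hR : ¬ IsField R) {x y : ℝ} (hx : 0 ≤ x)
    (hxy : x < y) : ∃ s : K, fieldAbs e he s ∈ Set.Ioo x y := by
  wlog hx' : 0 < x generalizing x
  · obtain ⟨s, h1, h2⟩ := this (x := (x + y) / 2) (by linarith) (by linarith) (by linarith)
    exact ⟨s, by linarith, h2⟩
  obtain ⟨ϖ, hϖ, hϖ1⟩ := exists_ringAbs_lt_one e he hR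
  have hpos : 0 < ringAbs e he ϖ := (ringAbs e he).pos hϖ
  have hlog : Real.log (ringAbs e he ϖ) < 0 := Real.log_neg hpos hϖ1
  obtain ⟨q, hq1, hq2⟩ := exists_rat_btwn
    (div_lt_div_of_neg_of_lt hlog (Real.log_lt_log hx' hxy))
  rw [div_lt_iff_of_neg hlog] at hq1
  rw [lt_div_iff_of_neg hlog] at hq2
  obtain ⟨α, hα⟩ := IsAlgClosed.exists_pow_nat_eq (algebraMap R K ϖ) q.den_pos
  have hα' : fieldAbs e he α ^ q.den = ringAbs e he ϖ := by
    rw [← map_pow, hα, ringAbs_apply]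
  have hden : (0 : ℝ) < q.den := by exact_mod_cast q.den_pos
  have hαpos : 0 < fieldAbs e he α := by
    refine (fieldAbs e he).pos ?_
    rintro rfl
    rw [map_zero, zero_pow q.den_pos.ne'] at hα'
    exact hpos.ne hα'
  have hval : Real.log (fieldAbs e he (α ^ q.num)) = q * Real.log (ringAbs e he ϖ) := by
    rw [← hα', map_zpow₀, Real.log_zpow, Real.log_pow, ← mul_assoc]
    congr 1
    exact_mod_cast (Rat.mul_den_eq_num q).symm
  have hspos : 0 < fieldAbs e he (α ^ q.num) := by
    rw [map_zpow₀]; exact zpow_pos hαpos _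
  refine ⟨α ^ q.num, ?_, ?_⟩
  · rwa [← Real.log_lt_log_iff hx' hspos, hval]
  · rwa [← Real.log_lt_log_iff hspos (hx'.trans hxy), hval]

/-- Over a valuation ring `R` with algebraically closed fraction field, every polynomial is a
product of constants, of polynomials `t - a` with `a ∈ R`, and of polynomials `b t - 1` with `b` in
the maximal ideal: a root in the fraction field lies in `R`, or its inverse `b` lies in the maximal
ideal. -/
theorem polynomial_induction_of_isAlgClosed (K : Type*) [Field K] [Algebra R K]
    [IsFractionRing R K] [IsAlgClosed K] {P : R[X] → Prop}
    (hC : ∀ a, P (C a)) (hX : ∀ a, P (X - C a))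
    (hb : ∀ b, IsLocalRing.residue R b = 0 → P (C b * X - 1))
    (hmul : ∀ p q, P p → P q → P (p * q)) (p : R[X]) : P p := by
  induction hn : p.natDegree using Nat.strong_induction_on generalizing p with
  | _ n ih =>
    rcases Nat.eq_zero_or_pos p.natDegree with h0 | h0
    · rw [eq_C_of_natDegree_eq_zero h0]; exact hC _
    have hinj := IsFractionRing.injective R K
    obtain ⟨r, hr⟩ := IsAlgClosed.exists_root (p.map (algebraMap R K)) (by
      rw [degree_map_eq_of_injective hinj]
      exact (natDegree_pos_iff_degree_pos.1 h0).ne')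
    by_cases hint : ∃ a, algebraMap R K a = r
    · obtain ⟨a, rfl⟩ := hint
      have hroot : p.IsRoot a := by
        apply hinj
        rw [← eval_map_apply, map_zero]; exact hr
      obtain ⟨q, rfl⟩ := dvd_iff_isRoot.2 hroot
      refine hmul _ _ (hX a) (ih q.natDegree ?_ q rfl)
      have hq : q ≠ 0 := by rintro rfl; simp at h0
      rw [← hn, natDegree_mul (X_sub_C_ne_zero a) hq, natDegree_X_sub_C]
      omega
    · obtain ⟨b, hbr⟩ := (ValuationRing.isInteger_or_isInteger R r).resolve_left
        fun ⟨a, ha⟩ => hint ⟨a, ha⟩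
      have hr0 : r ≠ 0 := by
        rintro rfl; exact hint ⟨0, map_zero _⟩
      have hbr' : algebraMap R K b * r = 1 := by rw [hbr, inv_mul_cancel₀ hr0]
      obtain ⟨q, rfl⟩ := exists_eq_mul_of_isRoot_inv hbr' hr
      have hres : IsLocalRing.residue R b = 0 := by
        by_contra h
        obtain ⟨u, rfl⟩ := (IsLocalRing.residue_ne_zero_iff_isUnit b).1 h
        refine hint ⟨((u⁻¹ : Rˣ) : R), ?_⟩
        have h1 : algebraMap R K u * algebraMap R K ((u⁻¹ : Rˣ) : R) = 1 := by
          rw [← map_mul, Units.mul_inv, map_one]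
        exact mul_left_cancel₀ (left_ne_zero_of_mul_eq_one h1) (h1.trans hbr'.symm)
      have hb0 : b ≠ 0 := by
        rintro rfl; simp at hbr'
      have hdeg : (C b * X - 1 : R[X]).natDegree = 1 := by
        rw [← C_1, natDegree_sub_C, natDegree_C_mul_X b hb0]
      refine hmul _ _ (hb b hres) (ih q.natDegree ?_ q rfl)
      have hq : q ≠ 0 := by rintro rfl; simp at h0
      rw [← hn, natDegree_mul (by rintro h; simp [h] at hdeg) hq, hdeg]
      omega

end ValuationRing

/-! ### Extension of seminorms to the fraction field -/

section Extension

variable {R : Type*} (K : Type*) [CommRing R] [IsDomain R] [Field K] [Algebra R K]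
  [IsFractionRing R K] {nrm : R → ℝ}

variable (R) in
/-- Every polynomial over the fraction field is a polynomial over the domain divided by a nonzero
constant. -/
theorem exists_C_mul_eq_map {K : Type*} [Field K] [Algebra R K] [IsFractionRing R K] (p : K[X]) :
    ∃ (b : R) (q : R[X]), b ≠ 0 ∧ C (algebraMap R K b) * p = q.map (algebraMap R K) := by
  obtain ⟨b, hb, h⟩ := IsLocalization.integerNormalization_spec (nonZeroDivisors R) p
  exact ⟨b, _, nonZeroDivisors.ne_zero hb, by rw [h, ← smul_eq_C_mul, algebraMap_smul]⟩

namespace AffineLine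

variable {K}

/-- The value at `p = q / b` of the extension of a seminorm from `R[t]` to `K[t]`. -/
noncomputable def extendFun (μ : AffineLine R nrm) (p : K[X]) : ℝ :=
  μ (exists_C_mul_eq_map R p).choose_spec.choose / μ (C (exists_C_mul_eq_map R p).choose)

theorem extendFun_eq {μ : AffineLine R nrm} (hμ : ∀ a, a ≠ 0 → μ (C a) ≠ 0) {p : K[X]} {b : R}
    {q : R[X]} (hb : b ≠ 0) (h : C (algebraMap R K b) * p = q.map (algebraMap R K)) :
    extendFun μ p = μ q / μ (C b) := by
  obtain ⟨hb', h'⟩ := (exists_C_mul_eq_map R p).choose_spec.choose_spec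
  rw [extendFun, div_eq_div_iff (hμ _ hb') (hμ _ hb), ← map_mul, ← map_mul]
  congr 1
  apply map_injective _ (IsFractionRing.injective R K)
  rw [Polynomial.map_mul, Polynomial.map_mul, map_C, map_C, ← h, ← h']
  ring

/-- A seminorm on `R[t]` that vanishes on no nonzero constant extends to `K[t]`. -/
noncomputable def extend (μ : AffineLine R nrm) (hμ : ∀ a, a ≠ 0 → μ (C a) ≠ 0) : MulRingSeminorm K[X] where
  toFun := extendFun μ
  map_zero' := by
    rw [extendFun_eq hμ (b := 1) (q := 0) one_ne_zero (by simp), map_zero, zero_div]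
  map_one' := by
    rw [extendFun_eq hμ (b := 1) (q := 1) one_ne_zero (by simp), C_1, map_one, div_one]
  neg' p := by
    obtain ⟨b, q, hb, h⟩ := exists_C_mul_eq_map R p
    rw [extendFun_eq hμ hb h, extendFun_eq hμ (q := -q) hb (by simp [h]), map_neg_eq_map]
  add_le' p₁ p₂ := by
    obtain ⟨b₁, q₁, hb₁, h₁⟩ := exists_C_mul_eq_map R p₁
    obtain ⟨b₂, q₂, hb₂, h₂⟩ := exists_C_mul_eq_map R p₂
    have h : C (algebraMap R K (b₁ * b₂)) * (p₁ + p₂) =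
        (C b₂ * q₁ + C b₁ * q₂).map (algebraMap R K) := by
      rw [Polynomial.map_add, Polynomial.map_mul, Polynomial.map_mul, ← h₁, ← h₂]
      simp only [map_mul, map_C]
      ring
    rw [extendFun_eq hμ hb₁ h₁, extendFun_eq hμ hb₂ h₂, extendFun_eq hμ (mul_ne_zero hb₁ hb₂) h,
      div_add_div _ _ (hμ _ hb₁) (hμ _ hb₂), C_mul, map_mul]
    refine div_le_div_of_nonneg_right ((map_add_le_add μ _ _).trans_eq ?_)
      (mul_nonneg (apply_nonneg μ _) (apply_nonneg μ _))
    rw [map_mul, map_mul, mul_comm (μ (C b₂))]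
  map_mul' p₁ p₂ := by
    obtain ⟨b₁, q₁, hb₁, h₁⟩ := exists_C_mul_eq_map R p₁
    obtain ⟨b₂, q₂, hb₂, h₂⟩ := exists_C_mul_eq_map R p₂
    have h : C (algebraMap R K (b₁ * b₂)) * (p₁ * p₂) = (q₁ * q₂).map (algebraMap R K) := by
      rw [Polynomial.map_mul, ← h₁, ← h₂, map_mul, C_mul]
      ring
    rw [extendFun_eq hμ hb₁ h₁, extendFun_eq hμ hb₂ h₂, extendFun_eq hμ (mul_ne_zero hb₁ hb₂) h,
      div_mul_div_comm, C_mul, map_mul, map_mul]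

theorem extend_map {μ : AffineLine R nrm} (hμ : ∀ a, a ≠ 0 → μ (C a) ≠ 0) (q : R[X]) :
    μ.extend hμ (q.map (algebraMap R K)) = μ q := by
  change extendFun μ _ = _
  rw [extendFun_eq hμ (b := 1) (q := q) one_ne_zero (by simp), C_1, map_one, div_one]

theorem isNonarchimedean_extend {v : AbsoluteValue R ℝ} (hv : IsNonarchimedean v)
    {μ : AffineLine R v} (hμ : ∀ a, a ≠ 0 → μ (C a) ≠ 0) :
    IsNonarchimedean (μ.extend (K := K) hμ) := by
  intro p₁ p₂
  obtain ⟨b₁, q₁, hb₁, h₁⟩ := exists_C_mul_eq_map R p₁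
  obtain ⟨b₂, q₂, hb₂, h₂⟩ := exists_C_mul_eq_map R p₂
  set b := b₁ * b₂ with hb
  have hb0 : algebraMap R K b ≠ 0 := by
    rw [Ne, FaithfulSMul.algebraMap_eq_zero_iff]; exact mul_ne_zero hb₁ hb₂
  have hpos : 0 < μ.extend (K := K) hμ (C (algebraMap R K b)) := by
    rw [← map_C, extend_map]
    exact lt_of_le_of_ne (apply_nonneg μ _) (hμ _ (mul_ne_zero hb₁ hb₂)).symm
  -- After multiplication by a common denominator the inequality is the one for `μ`.
  refine le_of_mul_le_mul_left ?_ hpos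
  have e₁ : C (algebraMap R K b) * p₁ = (C b₂ * q₁).map (algebraMap R K) := by
    rw [Polynomial.map_mul, ← h₁, map_C, hb, map_mul, C_mul]; ring
  have e₂ : C (algebraMap R K b) * p₂ = (C b₁ * q₂).map (algebraMap R K) := by
    rw [Polynomial.map_mul, ← h₂, map_C, hb, map_mul, C_mul]; ring
  rw [mul_max_of_nonneg _ _ hpos.le, ← map_mul, ← map_mul, ← map_mul, mul_add, e₁, e₂,
    ← Polynomial.map_add, extend_map, extend_map, extend_map]
  exact μ.isNonarchimedean hv _ _

end AffineLine

end Extension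

/-! ### The image of `Λ` and the image of the affine line over the residue field -/

section ValuationRing

variable {R K : Type*} [CommRing R] [IsDomain R] [ValuationRing R] [Field K] [Algebra R K]
  [IsFractionRing R K]
variable (e : ValuationRing.ValueGroup R K →*₀ ℝ≥0) (he : StrictMono e)

theorem isNonarchimedean_ringAbs : IsNonarchimedean (ringAbs e he) := fun a b => by
  simpa only [ringAbs_apply, map_add] using isNonarchimedean_fieldAbs e he _ _

theorem lambdaMap_apply (x : AffineLine K (fieldAbs e he) × Set.Ici (1 : ℝ)) (p : R[X]) :
    lambdaMap e he x p = x.1 (p.map (algebraMap R K)) ^ (x.2 : ℝ) := rfl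

theorem resMap_apply (μ : AffineLine (IsLocalRing.ResidueField R)
      (trivialAbs (IsLocalRing.ResidueField R))) (p : R[X]) :
    resMap e he μ p = μ (p.map (IsLocalRing.residue R)) := rfl

theorem powMap_apply (ω : Set.Ici (1 : ℝ))
    (μ : AffineLine K (fun a => fieldAbs e he a ^ (ω : ℝ))) (p : R[X]) :
    powMap e he ω μ p = μ (p.map (algebraMap R K)) := rfl

theorem lambdaMap_C (x : AffineLine K (fieldAbs e he) × Set.Ici (1 : ℝ)) (a : R) :
    lambdaMap e he x (C a) = ringAbs e he a ^ (x.2 : ℝ) := by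
  rw [lambdaMap_apply, map_C, AffineLine.apply_C, ringAbs_apply]

variable {e he}

/-- Since `R` has rank one, some power of `ϖ` is a multiple of any given nonzero element, so a
seminorm with a nonzero value at `ϖ` has nonzero values at all nonzero constants. -/
theorem apply_C_ne_zero {μ : AffineLine R (ringAbs e he)} {ϖ : R} (hϖ1 : ringAbs e he ϖ < 1)
    (hμ : μ (C ϖ) ≠ 0) {a : R} (ha : a ≠ 0) : μ (C a) ≠ 0 := by
  obtain ⟨n, hn⟩ := exists_pow_lt_of_lt_one ((ringAbs e he).pos ha) hϖ1
  have ha' : algebraMap R K a ≠ 0 := by rwa [Ne, FaithfulSMul.algebraMap_eq_zero_iff]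
  obtain ⟨c, hc⟩ := (fieldAbs_le_one_iff e he (algebraMap R K (ϖ ^ n) / algebraMap R K a)).1 (by
    rw [map_div₀, ← ringAbs_apply, ← ringAbs_apply, map_pow]
    exact div_le_one_of_le₀ hn.le ((ringAbs e he).nonneg _))
  have h : ϖ ^ n = c * a := IsFractionRing.injective R K (by
    rw [map_mul, hc, div_mul_cancel₀ _ ha'])
  intro h0
  have := congrArg (fun x => μ (C x)) h
  simp only [map_pow, map_mul, h0, mul_zero] at this
  exact pow_ne_zero n hμ this

/-- If `μ` vanishes at no nonzero constant, then its extension to `K[t]` restricts to an absolute value of `K`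
that is at most `|·|` on `R`, hence is a power `|·| ^ ω` with `ω ≥ 1`. -/
theorem exists_extend_C_eq_rpow {μ : AffineLine R (ringAbs e he)} {ϖ : R} (hϖ : ϖ ≠ 0)
    (hϖ1 : ringAbs e he ϖ < 1) (hμ : ∀ a, a ≠ 0 → μ (C a) ≠ 0) :
    ∃ ω : ℝ, 1 ≤ ω ∧ ∀ x : K, μ.extend (K := K) hμ (C x) = fieldAbs e he x ^ ω := by
  set ν := μ.extend (K := K) hμ with hν
  let w : AbsoluteValue K ℝ :=
    { toFun := fun x => ν (C x)
      map_mul' := fun x y => by rw [C_mul, map_mul]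
      nonneg' := fun x => apply_nonneg ν _
      eq_zero' := fun x => by
        refine ⟨fun h => ?_, fun h => by rw [h, C_0, map_zero]⟩
        by_contra hx
        have h1 : ν (C x) * ν (C x⁻¹) = 1 := by
          rw [← map_mul, ← C_mul, mul_inv_cancel₀ hx, C_1, map_one]
        rw [h, zero_mul] at h1
        exact zero_ne_one h1
      add_le' := fun x y => by rw [C_add]; exact map_add_le_add ν _ _ }
  have hwR : ∀ a : R, w (algebraMap R K a) = μ (C a) := fun a => by
    change ν (C _) = _
    rw [← map_C, hν, AffineLine.extend_map]
  have hpos : 0 < ringAbs e he ϖ := (ringAbs e he).pos hϖ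
  have hnt : (fieldAbs e he).IsNontrivial :=
    ⟨algebraMap R K ϖ, by rwa [Ne, FaithfulSMul.algebraMap_eq_zero_iff], hϖ1.ne⟩
  have hequiv : (fieldAbs e he).IsEquiv w := by
    refine AbsoluteValue.isEquiv_of_lt_one_imp hnt fun x hx => ?_
    obtain ⟨a, rfl⟩ := (fieldAbs_le_one_iff e he x).1 hx.le
    rw [hwR]
    exact (μ.contractive a).trans_lt hx
  obtain ⟨ω, -, hω⟩ := AbsoluteValue.isEquiv_iff_exists_rpow_eq.1 hequiv
  refine ⟨ω, ?_, fun x => (congrFun hω x).symm⟩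
  have h1 : ringAbs e he ϖ ^ ω ≤ ringAbs e he ϖ ^ (1 : ℝ) := by
    rw [Real.rpow_one]
    exact ((congrFun hω (algebraMap R K ϖ)).trans (hwR ϖ)).trans_le (μ.contractive ϖ)
  exact (Real.rpow_le_rpow_left_iff_of_base_lt_one hpos hϖ1).1 h1

/-- The image of `Λ` consists of the points that do not vanish at a given `ϖ` with
`0 < |ϖ| < 1`. -/
theorem mem_range_lambdaMap_iff {μ : AffineLine R (ringAbs e he)} {ϖ : R} (hϖ : ϖ ≠ 0)
    (hϖ1 : ringAbs e he ϖ < 1) : μ ∈ Set.range (lambdaMap e he) ↔ μ (C ϖ) ≠ 0 := by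
  constructor
  · rintro ⟨x, rfl⟩
    rw [lambdaMap_C]
    exact (Real.rpow_pos_of_pos ((ringAbs e he).pos hϖ) _).ne'
  intro h
  have hμ : ∀ a, a ≠ 0 → μ (C a) ≠ 0 := fun a ha => apply_C_ne_zero hϖ1 h ha
  obtain ⟨ω, hω1, hω⟩ := exists_extend_C_eq_rpow hϖ hϖ1 hμ
  have hna := AffineLine.isNonarchimedean_extend (K := K) (isNonarchimedean_ringAbs e he) hμ
  have hω0 : 0 < ω := zero_lt_one.trans_le hω1
  have hinv : 0 ≤ ω⁻¹ := inv_nonneg.2 hω0.le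
  set ν := μ.extend (K := K) hμ with hν
  let l : AffineLine K (fieldAbs e he) :=
    { toFun := fun p => ν p ^ ω⁻¹
      map_zero' := by rw [map_zero, Real.zero_rpow (inv_pos.2 hω0).ne']
      map_one' := by rw [map_one, Real.one_rpow]
      neg' := fun p => by rw [map_neg_eq_map]
      add_le' := fun p q => by
        have hp := Real.rpow_nonneg (apply_nonneg ν p) ω⁻¹
        have hq := Real.rpow_nonneg (apply_nonneg ν q) ω⁻¹
        refine (Real.rpow_le_rpow (apply_nonneg ν _) (hna p q) hinv).trans ?_
        rcases max_cases (ν p) (ν q) with ⟨h, -⟩ | ⟨h, -⟩ <;> rw [h] <;> linarith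
      map_mul' := fun p q => by
        rw [map_mul, Real.mul_rpow (apply_nonneg ν p) (apply_nonneg ν q)]
      contractive' := fun a => by
        change ν (C a) ^ ω⁻¹ ≤ _
        rw [hω, Real.rpow_rpow_inv ((fieldAbs e he).nonneg a) hω0.ne'] }
  refine ⟨(l, ⟨ω, hω1⟩), DFunLike.ext _ _ fun p => ?_⟩
  rw [lambdaMap_apply]
  change (ν (p.map _) ^ ω⁻¹) ^ ω = _
  rw [Real.rpow_inv_rpow (apply_nonneg ν _) hω0.ne', hν, AffineLine.extend_map]

theorem isOpen_range_lambdaMap (hR : ¬ IsField R) : IsOpen (Set.range (lambdaMap e he)) := by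
  obtain ⟨ϖ, hϖ, hϖ1⟩ := exists_ringAbs_lt_one e he hR
  have h : Set.range (lambdaMap e he) = (fun μ => μ (C ϖ)) ⁻¹' {0}ᶜ :=
    Set.ext fun μ => mem_range_lambdaMap_iff hϖ hϖ1
  rw [h]
  exact isOpen_compl_singleton.preimage (AffineLine.continuous_eval _)

/-- Points in the image of some `J_ω` do not vanish at `ϖ`, as `ϖ` is invertible in `K`. -/
theorem range_lambdaMap_eq_iUnion (hR : ¬ IsField R) :
    Set.range (lambdaMap e he) = ⋃ ω : Set.Ici (1 : ℝ), Set.range (powMap e he ω) := by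
  obtain ⟨ϖ, hϖ, hϖ1⟩ := exists_ringAbs_lt_one e he hR
  refine Set.Subset.antisymm ?_ (Set.iUnion_subset fun ω => ?_)
  · rintro _ ⟨x, rfl⟩
    exact Set.mem_iUnion.2 ⟨x.2, _, rfl⟩
  · rintro _ ⟨μ, rfl⟩
    refine (mem_range_lambdaMap_iff hϖ hϖ1).2 fun h => ?_
    have hϖ' : algebraMap R K ϖ ≠ 0 := by rwa [Ne, FaithfulSMul.algebraMap_eq_zero_iff]
    have h1 : μ (C (algebraMap R K ϖ)) * μ (C (algebraMap R K ϖ)⁻¹) = 1 := by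
      rw [← map_mul, ← C_mul, mul_inv_cancel₀ hϖ', C_1, map_one]
    rw [powMap_apply, map_C] at h
    rw [h, zero_mul] at h1
    exact zero_ne_one h1

/-- If `Λ (lᵢ, ωᵢ)` converges to `Λ (l, ω)`, then `ωᵢ = log |ϖ|_i / log |ϖ|` converges to `ω`, and
the values of `lᵢ` at a fraction `q / b` converge, being determined by those at `q` and `b`. -/
theorem tendsto_of_tendsto_lambdaMap (hR : ¬ IsField R) {ι : Type*} {f : Filter ι}
    {x : ι → AffineLine K (fieldAbs e he) × Set.Ici (1 : ℝ)}
    {x₀ : AffineLine K (fieldAbs e he) × Set.Ici (1 : ℝ)}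
    (h : Tendsto (fun i => lambdaMap e he (x i)) f (𝓝 (lambdaMap e he x₀))) :
    Tendsto x f (𝓝 x₀) := by
  obtain ⟨ϖ, hϖ, hϖ1⟩ := exists_ringAbs_lt_one e he hR
  have hpos : 0 < ringAbs e he ϖ := (ringAbs e he).pos hϖ
  have hlog : Real.log (ringAbs e he ϖ) ≠ 0 := (Real.log_neg hpos hϖ1).ne
  rw [AffineLine.tendsto_nhds_iff] at h
  have hω : Tendsto (fun i => ((x i).2 : ℝ)) f (𝓝 (x₀.2 : ℝ)) := by
    have h1 := h (C ϖ)
    simp only [lambdaMap_C] at h1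
    have h2 := (h1.log (Real.rpow_pos_of_pos hpos _).ne').div_const (Real.log (ringAbs e he ϖ))
    simpa only [Real.log_rpow hpos, mul_div_cancel_right₀ _ hlog] using h2
  have hω0 : ∀ ω : Set.Ici (1 : ℝ), (ω : ℝ) ≠ 0 := fun ω =>
    (zero_lt_one.trans_le ω.2).ne'
  have hl : ∀ q : R[X], Tendsto (fun i => (x i).1 (q.map (algebraMap R K))) f
      (𝓝 (x₀.1 (q.map (algebraMap R K)))) := fun q => by
    have h1 := (h q).rpow (hω.inv₀ (hω0 _)) (Or.inr (inv_pos.2 (zero_lt_one.trans_le x₀.2.2)))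
    simpa only [lambdaMap_apply, Real.rpow_rpow_inv (apply_nonneg _ _) (hω0 _)] using h1
  refine Prod.tendsto_iff _ _ |>.2 ⟨AffineLine.tendsto_nhds_iff.2 fun p => ?_,
    tendsto_subtype_rng.2 hω⟩
  obtain ⟨b, q, hb, hbq⟩ := exists_C_mul_eq_map R p
  have hv : fieldAbs e he (algebraMap R K b) ≠ 0 := (ringAbs e he).ne_zero hb
  have hp : ∀ l : AffineLine K (fieldAbs e he),
      l p = l (q.map (algebraMap R K)) / fieldAbs e he (algebraMap R K b) := fun l => by
    rw [← hbq, map_mul, AffineLine.apply_C, mul_div_cancel_left₀ _ hv]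
  simp only [hp]
  exact (hl q).div_const _

theorem continuous_lambdaMap : Continuous (lambdaMap e he) := by
  refine AffineLine.continuous_iff.2 fun p => ?_
  simp only [lambdaMap_apply]
  exact ((AffineLine.continuous_eval _).comp continuous_fst).rpow
    (continuous_subtype_val.comp continuous_snd) fun x => Or.inr (zero_lt_one.trans_le x.2.2)

theorem isEmbedding_lambdaMap (hR : ¬ IsField R) : IsEmbedding (lambdaMap e he) := by
  have hind : IsInducing (lambdaMap e he) := isInducing_iff_nhds.2 fun x =>
    le_antisymm (continuous_lambdaMap.tendsto x).le_comap
      (tendsto_of_tendsto_lambdaMap (x := id) hR tendsto_comap)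
  refine ⟨hind, fun x y hxy => ?_⟩
  have : T2Space (AffineLine K (fieldAbs e he)) :=
    T2Space.of_injective_continuous (f := fun μ p => μ p) DFunLike.coe_injective
      continuous_induced_dom
  -- Injectivity is the convergence statement for a constant family, as limits are unique.
  exact tendsto_nhds_unique (tendsto_of_tendsto_lambdaMap (f := pure ()) (x := fun _ => y) hR
    (by rw [hxy]; exact tendsto_const_nhds)) tendsto_const_nhds

theorem apply_eq_of_map_residue_eq {μ : AffineLine R (ringAbs e he)}
    (hμ : ∀ a, IsLocalRing.residue R a = 0 → μ (C a) = 0) {p q : R[X]}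
    (hpq : p.map (IsLocalRing.residue R) = q.map (IsLocalRing.residue R)) : μ p = μ q := by
  have h0 : μ (p - q) = 0 := by
    refine le_antisymm ?_ (apply_nonneg μ _)
    rw [(p - q).as_sum_support_C_mul_X_pow]
    refine (Finset.le_sum_of_subadditive μ (map_zero μ).le (map_add_le_add μ) _ _).trans
      (Finset.sum_eq_zero fun n _ => ?_).le
    have hn := congrArg (fun f => coeff f n) hpq
    simp only [coeff_map] at hn
    rw [map_mul, hμ _ (by rw [coeff_sub, map_sub, hn, sub_self]), zero_mul]
  have h := abs_sub_map_le_sub μ p q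
  rw [h0] at h
  exact sub_eq_zero.1 (abs_nonpos_iff.1 h)

/-- The points coming from the residue field are those that vanish on the maximal ideal. -/
theorem mem_range_resMap_iff {μ : AffineLine R (ringAbs e he)} :
    μ ∈ Set.range (resMap e he) ↔ ∀ a, IsLocalRing.residue R a = 0 → μ (C a) = 0 := by
  constructor
  · rintro ⟨ν, rfl⟩ a ha
    rw [resMap_apply, map_C, ha, C_0, map_zero]
  intro hμ
  have hsurj : Function.Surjective (Polynomial.map (IsLocalRing.residue R)) :=
    map_surjective _ IsLocalRing.residue_surjective
  set g := Function.surjInv hsurj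
  have hg : ∀ p, (g p).map (IsLocalRing.residue R) = p := Function.surjInv_eq hsurj
  have heq : ∀ q : R[X], μ (g (q.map (IsLocalRing.residue R))) = μ q := fun q =>
    apply_eq_of_map_residue_eq hμ (hg _)
  let ν : AffineLine (IsLocalRing.ResidueField R)
      (trivialAbs (IsLocalRing.ResidueField R)) :=
    { toFun := fun p => μ (g p)
      map_zero' := by rw [← map_zero μ, ← heq 0, Polynomial.map_zero]
      map_one' := by rw [← map_one μ, ← heq 1, Polynomial.map_one]
      neg' := fun p => by
        rw [← map_neg_eq_map μ (g p), ← heq (-g p), Polynomial.map_neg, hg]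
      add_le' := fun p q => by
        rw [← hg p, ← hg q, ← Polynomial.map_add]
        simp only [heq]
        exact map_add_le_add μ _ _
      map_mul' := fun p q => by
        rw [← hg p, ← hg q, ← Polynomial.map_mul]
        simp only [heq]
        exact map_mul μ _ _
      contractive' := fun x => by
        obtain ⟨a, rfl⟩ := IsLocalRing.residue_surjective x
        rw [← map_C, heq]
        by_cases ha : IsLocalRing.residue R a = 0
        · rw [ha, map_zero, hμ a ha]
        · classical
          rw [trivialAbs, AbsoluteValue.trivial_apply ha]
          exact (μ.contractive a).trans (ringAbs_le_one e he a) }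
  exact ⟨ν, DFunLike.ext _ _ heq⟩

theorem isClosedEmbedding_resMap : IsClosedEmbedding (resMap e he) := by
  have hsurj : Function.Surjective (Polynomial.map (IsLocalRing.residue R)) :=
    map_surjective _ IsLocalRing.residue_surjective
  have hind : IsInducing (resMap e he) := isInducing_iff_nhds.2 fun μ => by
    refine le_antisymm (Tendsto.le_comap ?_) ?_
    · refine AffineLine.tendsto_nhds_iff.2 fun p => ?_
      exact (AffineLine.continuous_eval (p.map (IsLocalRing.residue R))).tendsto μ
    · change Tendsto id (comap (resMap e he) (𝓝 (resMap e he μ))) (𝓝 μ)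
      refine AffineLine.tendsto_nhds_iff.2 fun p => ?_
      obtain ⟨q, rfl⟩ := hsurj p
      exact AffineLine.tendsto_nhds_iff.1 tendsto_comap q
  refine ⟨⟨hind, fun μ ν h => DFunLike.ext _ _ fun p => ?_⟩, ?_⟩
  · obtain ⟨q, rfl⟩ := hsurj p
    exact DFunLike.congr_fun h q
  have hrange : Set.range (resMap e he) =
      ⋂ a ∈ {a : R | IsLocalRing.residue R a = 0}, (fun μ => μ (C a)) ⁻¹' {0} := by
    ext μ
    simp only [mem_range_resMap_iff, Set.mem_iInter, Set.mem_ofPred_eq, Set.mem_preimage,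
      Set.mem_singleton_iff]
  rw [hrange]
  exact isClosed_biInter fun a _ => isClosed_singleton.preimage (AffineLine.continuous_eval _)

end ValuationRing

/-! ### Density of the points of `K` in the affine line over `K` -/

section TypeOnePoints

variable {R K : Type*} [CommRing R] [IsDomain R] [ValuationRing R] [Field K] [Algebra R K]
  [IsFractionRing R K]
variable (e : ValuationRing.ValueGroup R K →*₀ ℝ≥0) (he : StrictMono e)

theorem zetaField_X_sub_C (s a : K) (τ : ℝ≥0) :
    zetaField e he s τ (X - C a) = max (τ : ℝ) (fieldAbs e he (s - a)) :=
  AffineLine.zeta_X_sub_C _ s a τ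

/-- If `A` is finite and `a₀ ∈ A` minimizes the value `d` of `l` at `t - a₀`, then the points
`a₀ + s` with `|s| > d` close to `d` approximate `l` at all the polynomials `t - a`, `a ∈ A`. -/
theorem exists_tendsto_zetaField_X_sub_C [IsAlgClosed K] (hR : ¬ IsField R)
    (l : AffineLine K (fieldAbs e he)) (A : Finset K) :
    ∃ G : Filter K, G.NeBot ∧
      ∀ a ∈ A, Tendsto (fun r => zetaField e he r 0 (X - C a)) G (𝓝 (l (X - C a))) := by
  rcases A.eq_empty_or_nonempty with rfl | hA
  · exact ⟨⊤, inferInstance, by simp⟩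
  obtain ⟨a₀, -, hmin⟩ := A.exists_min_image (fun a => l (X - C a)) hA
  set d := l (X - C a₀) with hd
  have hd0 : 0 ≤ d := apply_nonneg l _
  have hvna : IsNonarchimedean (fieldAbs e he) := isNonarchimedean_fieldAbs e he
  have hG : (comap (fieldAbs e he) (𝓝[>] d)).NeBot := comap_neBot_iff.2 fun t ht => by
    obtain ⟨u, hu, hut⟩ := (mem_nhdsGT_iff_exists_Ioo_subset).1 ht
    obtain ⟨s, hs⟩ := exists_fieldAbs_mem_Ioo e he hR hd0 hu
    exact ⟨s, hut hs⟩
  have hs : Tendsto (fieldAbs e he) (comap (fieldAbs e he) (𝓝[>] d)) (𝓝[>] d) := tendsto_comap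
  refine ⟨map (fun s => a₀ + s) (comap (fieldAbs e he) (𝓝[>] d)), hG.map _, fun a ha => ?_⟩
  rw [tendsto_map'_iff]
  have hval : ∀ s, zetaField e he (a₀ + s) 0 (X - C a) = fieldAbs e he (s + (a₀ - a)) := fun s => by
    rw [zetaField_X_sub_C, NNReal.coe_zero, max_eq_right ((fieldAbs e he).nonneg _)]
    congr 1; ring
  have hsplit : (X - C a : K[X]) = (X - C a₀) + C (a₀ - a) := by rw [C_sub]; ring
  have hlna := l.isNonarchimedean hvna
  rcases le_or_gt (fieldAbs e he (a₀ - a)) d with h | h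
  · have hla : l (X - C a) = d := by
      refine le_antisymm ?_ (hmin a ha)
      rw [hsplit]
      exact (hlna _ _).trans (max_le le_rfl ((l.contractive _).trans h))
    rw [hla]
    refine (tendsto_nhds_of_tendsto_nhdsWithin hs).congr' ?_
    filter_upwards [hs.eventually self_mem_nhdsWithin] with s hsd
    rw [Function.comp_apply, hval, add_comm]
    exact (AffineLine.add_eq_right_of_lt hvna (h.trans_lt hsd)).symm
  · have hla : l (X - C a) = fieldAbs e he (a₀ - a) := by
      rw [hsplit, ← AffineLine.apply_C l]
      exact AffineLine.add_eq_right_of_lt hlna (by rwa [AffineLine.apply_C])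
    rw [hla]
    refine tendsto_const_nhds.congr' ?_
    filter_upwards [(tendsto_nhds_of_tendsto_nhdsWithin hs).eventually (gt_mem_nhds h)] with s hsd
    rw [Function.comp_apply, hval]
    exact (AffineLine.add_eq_right_of_lt hvna hsd).symm

theorem apply_eq_prod_roots [IsAlgClosed K] (l : AffineLine K (fieldAbs e he)) (p : K[X]) :
    l p = fieldAbs e he p.leadingCoeff * (p.roots.map fun a => l (X - C a)).prod := by
  conv_lhs => rw [(IsAlgClosed.splits p).eq_prod_roots]
  rw [map_mul, AffineLine.apply_C, map_multiset_prod, Multiset.map_map]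
  rfl

/-- The points of `K` are dense in the affine line over `K`, since values at finitely many
polynomials are determined by the values at their linear factors. -/
theorem dense_range_zetaField [IsAlgClosed K] (hR : ¬ IsField R) :
    Dense (Set.range fun r : K => zetaField e he r 0) := by
  intro l
  rw [mem_closure_iff_nhds]
  intro t ht
  rw [nhds_induced, mem_comap] at ht
  obtain ⟨U, hU, hUt⟩ := ht
  rw [nhds_pi, Filter.mem_pi] at hU
  obtain ⟨I, hI, V, hV, hIU⟩ := hU
  classical
  obtain ⟨G, hG, hGl⟩ := exists_tendsto_zetaField_X_sub_C e he hR l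
    (hI.toFinset.biUnion fun p => p.roots.toFinset)
  have hlim : ∀ p ∈ I, Tendsto (fun r => zetaField e he r 0 p) G (𝓝 (l p)) := fun p hp => by
    rw [apply_eq_prod_roots e he l p]
    refine Tendsto.congr (fun r => (apply_eq_prod_roots e he (zetaField e he r 0) p).symm) ?_
    refine (tendsto_multiset_prod _ fun a ha => hGl a ?_).const_mul _
    exact Finset.mem_biUnion.2 ⟨p, hI.mem_toFinset.2 hp, Multiset.mem_toFinset.2 ha⟩
  have hev : ∀ᶠ r in G, ∀ p ∈ I, zetaField e he r 0 p ∈ V p :=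
    (eventually_all_finite hI).2 fun p hp => (hlim p hp).eventually (hV p)
  obtain ⟨r, hr⟩ := hev.exists
  exact ⟨_, hUt (hIU hr), r, rfl⟩

end TypeOnePoints

/-! ### The affine line over the residue field -/

section ResidueLine

variable {R K : Type*} [CommRing R] [IsDomain R] [ValuationRing R] [Field K] [Algebra R K]
  [IsFractionRing R K]

theorem trivialAbs_of_ne_zero {k : Type*} [Field k] {x : k} (hx : x ≠ 0) : trivialAbs k x = 1 := by
  classical exact AbsoluteValue.trivial_apply hx

theorem zetaRes_X_sub_C (s a : IsLocalRing.ResidueField R) (τ : ℝ≥0) :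
    zetaRes R s τ (X - C a) = max (τ : ℝ) (trivialAbs _ (s - a)) :=
  AffineLine.zeta_X_sub_C _ s a τ

/-- The points over the residue field are determined by their values at the polynomials `t - x`,
since the polynomials `b t - 1` with `b` in the maximal ideal reduce to constants. -/
theorem residue_point_ext (K : Type*) [Field K] [Algebra R K] [IsFractionRing R K] [IsAlgClosed K]
    {μ ν : AffineLine (IsLocalRing.ResidueField R) (trivialAbs (IsLocalRing.ResidueField R))}
    (h : ∀ x, μ (X - C x) = ν (X - C x)) : μ = ν := by
  have key : ∀ p : R[X], μ (p.map (IsLocalRing.residue R)) = ν (p.map (IsLocalRing.residue R)) := by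
    refine polynomial_induction_of_isAlgClosed K (fun a => ?_) (fun a => ?_) (fun b hb => ?_)
      (fun p q hp hq => ?_)
    · rw [map_C, AffineLine.apply_C, AffineLine.apply_C]
    · rw [Polynomial.map_sub, map_X, map_C, h]
    · rw [Polynomial.map_sub, Polynomial.map_mul, map_C, hb, C_0, zero_mul, Polynomial.map_one,
        zero_sub, map_neg_eq_map, map_neg_eq_map, map_one, map_one]
    · rw [Polynomial.map_mul, map_mul, map_mul, hp, hq]
  refine DFunLike.ext _ _ fun p => ?_
  obtain ⟨q, rfl⟩ := map_surjective _ IsLocalRing.residue_surjective p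
  exact key q

/-- The affine line over the residue field consists of segments `ζ_{x,τ}`, `τ ≤ 1`, one for each
`x`, joined to the ray `ζ_{0,τ}`, `τ ≥ 1`, at `ζ_{0,1}`. -/
theorem eq_zetaRes (K : Type*) [Field K] [Algebra R K] [IsFractionRing R K] [IsAlgClosed K]
    (l : AffineLine (IsLocalRing.ResidueField R) (trivialAbs (IsLocalRing.ResidueField R))) :
    (∃ τ : ℝ≥0, τ < 1 ∧ ∃ b : R, l = zetaRes R (IsLocalRing.residue R b) τ) ∨
      (∃ τ : ℝ≥0, 1 < τ ∧ l = zetaRes R 0 τ) ∨ l = zetaRes R 0 1 := by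
  have hna := l.isNonarchimedean (isNonarchimedean_trivialAbs _)
  rcases lt_or_ge 1 (l X) with h1 | h1
  · obtain ⟨τ, hτ⟩ : ∃ τ : ℝ≥0, (τ : ℝ) = l X := ⟨⟨l X, apply_nonneg l _⟩, rfl⟩
    refine Or.inr (Or.inl ⟨τ, NNReal.one_lt_coe.1 (hτ ▸ h1), residue_point_ext K fun x => ?_⟩)
    have hx := trivialAbs_le_one (0 - x)
    rw [zetaRes_X_sub_C, hτ, max_eq_left (hx.trans h1.le), sub_eq_add_neg, add_comm, ← C_neg]
    refine AffineLine.add_eq_right_of_lt hna ?_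
    rw [AffineLine.apply_C, ← zero_sub]
    exact hx.trans_lt h1
  by_cases h2 : ∃ x, l (X - C x) < 1
  · obtain ⟨x, hx⟩ := h2
    obtain ⟨b, rfl⟩ := IsLocalRing.residue_surjective x
    obtain ⟨τ, hτ⟩ : ∃ τ : ℝ≥0, (τ : ℝ) = l (X - C (IsLocalRing.residue R b)) :=
      ⟨⟨_, apply_nonneg l _⟩, rfl⟩
    refine Or.inl ⟨τ, NNReal.coe_lt_one.1 (hτ ▸ hx), b, residue_point_ext K fun y => ?_⟩
    set x := IsLocalRing.residue R b
    rw [zetaRes_X_sub_C, hτ]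
    rcases eq_or_ne x y with hxy | hxy
    · rw [hxy, sub_self, map_zero, max_eq_left (apply_nonneg l _)]
    have hv : trivialAbs _ (x - y) = 1 := trivialAbs_of_ne_zero (sub_ne_zero.2 hxy)
    have hsplit : (X - C y : (IsLocalRing.ResidueField R)[X]) = (X - C x) + C (x - y) := by
      rw [C_sub]; ring
    rw [hv, max_eq_right hx.le, hsplit, ← hv, ← AffineLine.apply_C l]
    refine AffineLine.add_eq_right_of_lt hna ?_
    rwa [AffineLine.apply_C, hv]
  · push Not at h2
    refine Or.inr (Or.inr (residue_point_ext K fun x => ?_))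
    rw [zetaRes_X_sub_C, NNReal.coe_one, max_eq_left (trivialAbs_le_one _)]
    refine le_antisymm ?_ (h2 x)
    rw [sub_eq_add_neg, ← C_neg]
    refine (hna _ _).trans (max_le h1 ?_)
    rw [AffineLine.apply_C]
    exact trivialAbs_le_one _

end ResidueLine

/-! ### Convergence to points over the residue field -/

section Convergence

variable {R K : Type*} [CommRing R] [IsDomain R] [ValuationRing R] [Field K] [Algebra R K]
  [IsFractionRing R K]
variable {e : ValuationRing.ValueGroup R K →*₀ ℝ≥0} {he : StrictMono e}
  {ι : Type*} {f : Filter ι}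

theorem tendsto_ringAbs_rpow {ω : ι → ℝ} (hω : Tendsto ω f atTop) (a : R) :
    Tendsto (fun i => ringAbs e he a ^ ω i) f
      (𝓝 (trivialAbs (IsLocalRing.ResidueField R) (IsLocalRing.residue R a))) := by
  by_cases ha : IsLocalRing.residue R a = 0
  · rw [ha, map_zero]
    exact (tendsto_rpow_atTop_of_base_lt_one _
      (neg_one_lt_zero.trans_le ((ringAbs e he).nonneg a))
      ((ringAbs_lt_one_iff e he).2 ha)).comp hω
  · rw [trivialAbs_of_ne_zero ha, ringAbs_eq_one_of_isUnit e he
      ((IsLocalRing.residue_ne_zero_iff_isUnit a).1 ha)]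
    simp only [Real.one_rpow]
    exact tendsto_const_nhds

theorem lambdaMap_X_sub_C (x : AffineLine K (fieldAbs e he) × Set.Ici (1 : ℝ)) (a : R) :
    lambdaMap e he x (X - C a) = x.1 (X - C (algebraMap R K a)) ^ (x.2 : ℝ) := by
  rw [lambdaMap_apply, Polynomial.map_sub, map_X, map_C]

theorem tendsto_apply_of_sub {g : ι → AffineLine R (ringAbs e he)} {p q : R[X]} {c : ℝ}
    (hp : Tendsto (fun i => g i p) f (𝓝 c)) (hpq : Tendsto (fun i => g i (q - p)) f (𝓝 0)) :
    Tendsto (fun i => g i q) f (𝓝 c) := by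
  have h := squeeze_zero_norm (f := fun i => g i q - g i p)
    (fun i => abs_sub_map_le_sub (g i) q p) hpq
  simpa using hp.add h

variable {x : ι → AffineLine K (fieldAbs e he) × Set.Ici (1 : ℝ)}

/-- As `ω → ∞`, convergence to a point over the residue field may be tested on the polynomials
`t - a` with `a ∈ R`: on constants it is automatic, and so it is on `b t - 1` with `|b| < 1`, as
`|b t|` tends to `0`. -/
theorem tendsto_lambdaMap_of_X_sub_C [IsAlgClosed K]
    {l₀ : AffineLine (IsLocalRing.ResidueField R) (trivialAbs (IsLocalRing.ResidueField R))}
    (hω : Tendsto (fun i => ((x i).2 : ℝ)) f atTop)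
    (h : ∀ a : R, Tendsto (fun i => lambdaMap e he (x i) (X - C a)) f
      (𝓝 (l₀ (X - C (IsLocalRing.residue R a))))) :
    Tendsto (fun i => lambdaMap e he (x i)) f (𝓝 (resMap e he l₀)) := by
  have hC : ∀ a : R, Tendsto (fun i => lambdaMap e he (x i) (C a)) f
      (𝓝 (resMap e he l₀ (C a))) := fun a => by
    simp only [lambdaMap_C]
    rw [resMap_apply, map_C, AffineLine.apply_C]
    exact tendsto_ringAbs_rpow hω a
  refine AffineLine.tendsto_nhds_iff.2 (polynomial_induction_of_isAlgClosed K hC (fun a => ?_)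
    (fun b hb => ?_) fun p q hp hq => ?_)
  · rw [resMap_apply, Polynomial.map_sub, map_X, map_C]
    exact h a
  · have h0 := (hC b).mul (h 0)
    have hb0 : resMap e he l₀ (C b) = 0 := by rw [resMap_apply, map_C, hb, C_0, map_zero]
    rw [hb0, zero_mul] at h0
    rw [resMap_apply, Polynomial.map_sub, Polynomial.map_mul, map_C, hb, C_0, zero_mul,
      Polynomial.map_one, zero_sub, map_neg_eq_map, map_one]
    refine tendsto_apply_of_sub (p := -1) ?_ ?_
    · simp only [map_neg_eq_map, map_one]
      exact tendsto_const_nhds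
    · refine h0.congr fun i => ?_
      rw [← map_mul]
      congr 1
      rw [C_0]; ring
  · rw [map_mul]
    simpa only [map_mul] using hp.mul hq

/-- The value at `ϖ` of a point over the residue field is `0`, so `|ϖ| ^ ωᵢ` tends to `0`. -/
theorem tendsto_atTop_of_tendsto_lambdaMap (hR : ¬ IsField R)
    {l₀ : AffineLine (IsLocalRing.ResidueField R) (trivialAbs (IsLocalRing.ResidueField R))}
    (h : Tendsto (fun i => lambdaMap e he (x i)) f (𝓝 (resMap e he l₀))) :
    Tendsto (fun i => ((x i).2 : ℝ)) f atTop := by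
  obtain ⟨ϖ, hϖ, hϖ1⟩ := exists_ringAbs_lt_one e he hR
  have hpos : 0 < ringAbs e he ϖ := (ringAbs e he).pos hϖ
  have hlog := Real.log_neg hpos hϖ1
  have h1 := AffineLine.tendsto_nhds_iff.1 h (C ϖ)
  rw [resMap_apply, map_C, (ringAbs_lt_one_iff e he).1 hϖ1, C_0, map_zero] at h1
  simp only [lambdaMap_C] at h1
  have h2 : Tendsto (fun i => ringAbs e he ϖ ^ ((x i).2 : ℝ)) f (𝓝[>] 0) :=
    tendsto_nhdsWithin_iff.2 ⟨h1, Eventually.of_forall fun i => Real.rpow_pos_of_pos hpos _⟩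
  have h3 := (Real.tendsto_log_nhdsGT_zero.comp h2).atBot_mul_const_of_neg (inv_lt_zero.2 hlog)
  refine h3.congr fun i => ?_
  rw [Function.comp_apply, Real.log_rpow hpos, ← div_eq_mul_inv, mul_div_cancel_right₀ _ hlog.ne]

/-- Convergence to `ζ_{x,τ}` with `τ < 1` is convergence at `t - b` for one lift `b` of `x`: the
distance of `b` from another `a ∈ R` tends to `0` or is `1`. -/
theorem tendsto_lambdaMap_zetaRes_of_lt_one [IsAlgClosed K] {τ : ℝ≥0} (hτ : τ < 1) {b : R}
    (hω : Tendsto (fun i => ((x i).2 : ℝ)) f atTop)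
    (h : Tendsto (fun i => lambdaMap e he (x i) (X - C b)) f (𝓝 τ)) :
    Tendsto (fun i => lambdaMap e he (x i)) f
      (𝓝 (resMap e he (zetaRes R (IsLocalRing.residue R b) τ))) := by
  refine tendsto_lambdaMap_of_X_sub_C hω fun a => ?_
  rw [zetaRes_X_sub_C]
  have hsplit : (X - C a : R[X]) = (X - C b) + C (b - a) := by rw [C_sub]; ring
  have hC : Tendsto (fun i => lambdaMap e he (x i) (C (b - a))) f
      (𝓝 (trivialAbs _ (IsLocalRing.residue R (b - a)))) := by
    simp only [lambdaMap_C]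
    exact tendsto_ringAbs_rpow hω _
  rw [← map_sub]
  by_cases hab : IsLocalRing.residue R (b - a) = 0
  · rw [hab, map_zero] at hC
    rw [hab, map_zero, max_eq_left τ.coe_nonneg]
    refine tendsto_apply_of_sub h (hC.congr fun i => ?_)
    rw [hsplit, add_sub_cancel_left]
  · rw [trivialAbs_of_ne_zero hab, max_eq_right (NNReal.coe_le_one.2 hτ.le)]
    refine tendsto_const_nhds.congr' ?_
    filter_upwards [h.eventually (gt_mem_nhds (NNReal.coe_lt_one.2 hτ))] with i hi
    have h1 : lambdaMap e he (x i) (C (b - a)) = 1 := by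
      rw [lambdaMap_C, ringAbs_eq_one_of_isUnit e he
        ((IsLocalRing.residue_ne_zero_iff_isUnit _).1 hab), Real.one_rpow]
    rw [hsplit, ← h1]
    exact (AffineLine.add_eq_right_of_lt
      ((lambdaMap e he (x i)).isNonarchimedean (isNonarchimedean_ringAbs e he))
      (by rwa [h1])).symm

/-- Convergence to `ζ_{0,τ}` with `τ > 1` is convergence at `t`, which dominates all `a ∈ R`. -/
theorem tendsto_lambdaMap_zetaRes_of_one_lt [IsAlgClosed K] {τ : ℝ≥0} (hτ : 1 < τ)
    (hω : Tendsto (fun i => ((x i).2 : ℝ)) f atTop)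
    (h : Tendsto (fun i => lambdaMap e he (x i) X) f (𝓝 τ)) :
    Tendsto (fun i => lambdaMap e he (x i)) f (𝓝 (resMap e he (zetaRes R 0 τ))) := by
  refine tendsto_lambdaMap_of_X_sub_C hω fun a => ?_
  have hτ' : (1 : ℝ) < τ := NNReal.one_lt_coe.2 hτ
  rw [zetaRes_X_sub_C, max_eq_left ((trivialAbs_le_one _).trans hτ'.le)]
  refine h.congr' ?_
  filter_upwards [h.eventually (lt_mem_nhds hτ')] with i hi
  rw [sub_eq_add_neg, add_comm, ← C_neg]
  refine (AffineLine.add_eq_right_of_lt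
    ((lambdaMap e he (x i)).isNonarchimedean (isNonarchimedean_ringAbs e he)) ?_).symm
  exact (((lambdaMap e he (x i)).contractive _).trans (ringAbs_le_one e he _)).trans_lt hi

theorem tendsto_lambdaMap_zetaRes_one [IsAlgClosed K] {F' : Set R}
    (hF' : Set.SurjOn (IsLocalRing.residue R) F' Set.univ)
    (hω : Tendsto (fun i => ((x i).2 : ℝ)) f atTop)
    (h : ∀ c ∈ F', Tendsto (fun i => lambdaMap e he (x i) (X - C c)) f (𝓝 1)) :
    Tendsto (fun i => lambdaMap e he (x i)) f (𝓝 (resMap e he (zetaRes R 0 1))) := by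
  refine tendsto_lambdaMap_of_X_sub_C hω fun a => ?_
  rw [zetaRes_X_sub_C, NNReal.coe_one, max_eq_left (trivialAbs_le_one _)]
  obtain ⟨c, hc, hca⟩ := hF' (Set.mem_univ (IsLocalRing.residue R a))
  refine tendsto_apply_of_sub (h c hc) ?_
  have hsub : (X - C a - (X - C c) : R[X]) = C (c - a) := by rw [C_sub]; ring
  have h0 := tendsto_ringAbs_rpow (e := e) (he := he) hω (c - a)
  rw [map_sub (IsLocalRing.residue R), hca, sub_self, map_zero] at h0
  simpa only [hsub, lambdaMap_C] using h0

/-- The point `ζ_{Q(b),τ}` is the limit of `Λ (ζ_{b, τ ^ (1 / n)}, n)`. -/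
theorem resMap_zetaRes_mem_closure [IsAlgClosed K] (b : R) (τ : ℝ≥0) :
    resMap e he (zetaRes R (IsLocalRing.residue R b) τ) ∈
      closure (Set.range (lambdaMap e he)) := by
  let x : ℕ → AffineLine K (fieldAbs e he) × Set.Ici (1 : ℝ) := fun n =>
    (zetaField e he (algebraMap R K b) (τ ^ ((n : ℝ) + 1)⁻¹),
      ⟨(n : ℝ) + 1, by simp⟩)
  have hω : Tendsto (fun n => ((x n).2 : ℝ)) atTop atTop :=
    tendsto_atTop_add_const_right _ _ tendsto_natCast_atTop_atTop
  refine mem_closure_of_tendsto (f := fun n => lambdaMap e he (x n)) (b := atTop)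
    (tendsto_lambdaMap_of_X_sub_C hω fun a => ?_) (Eventually.of_forall fun n => ⟨x n, rfl⟩)
  rw [zetaRes_X_sub_C, ← map_sub]
  refine (tendsto_const_nhds.max (tendsto_ringAbs_rpow (e := e) (he := he) hω (b - a))).congr
    fun n => ?_
  have hn : (0 : ℝ) < (n : ℝ) + 1 := by positivity
  rw [lambdaMap_X_sub_C]
  change max (τ : ℝ) (ringAbs e he (b - a) ^ ((n : ℝ) + 1)) =
    (zetaField e he _ _ (X - C _)) ^ ((n : ℝ) + 1)
  have hτ : (((τ ^ ((n : ℝ) + 1)⁻¹ : ℝ≥0) : ℝ)) ^ ((n : ℝ) + 1) = τ := by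
    rw [NNReal.coe_rpow, Real.rpow_inv_rpow τ.coe_nonneg hn.ne']
  rw [zetaField_X_sub_C, ← map_sub, ← ringAbs_apply,
    (Real.monotoneOn_rpow_Ici_of_exponent_nonneg hn.le).map_max (NNReal.coe_nonneg _)
      ((ringAbs e he).nonneg _), hτ]

theorem denseRange_lambdaMap [IsAlgClosed K] : DenseRange (lambdaMap e he) := by
  intro μ
  by_cases hμ : μ ∈ Set.range (lambdaMap e he)
  · exact subset_closure hμ
  obtain ⟨l₀, rfl⟩ := (mem_range_resMap_iff (μ := μ)).2 fun a ha => by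
    rcases eq_or_ne a 0 with rfl | ha0
    · rw [C_0, map_zero]
    by_contra h
    exact hμ ((mem_range_lambdaMap_iff ha0 ((ringAbs_lt_one_iff e he).2 ha)).2 h)
  rcases eq_zetaRes K l₀ with ⟨τ, -, b, rfl⟩ | ⟨τ, -, rfl⟩ | rfl
  · exact resMap_zetaRes_mem_closure b τ
  · simpa using resMap_zetaRes_mem_closure (e := e) (he := he) 0 τ
  · simpa using resMap_zetaRes_mem_closure (e := e) (he := he) 0 1

theorem dense_one_lt : Dense {ω : Set.Ici (1 : ℝ) | (1 : ℝ) < ω} := by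
  rw [Subtype.dense_iff]
  intro t ht
  have h : ((↑) '' {ω : Set.Ici (1 : ℝ) | (1 : ℝ) < ω} : Set ℝ) = Set.Ioi 1 := by
    ext r
    exact ⟨fun ⟨ω, hω, h⟩ => h ▸ hω, fun hr => ⟨⟨r, Set.mem_Ici.2 (Set.mem_Ioi.1 hr).le⟩, hr, rfl⟩⟩
  rwa [h, closure_Ioi]

/-- Convergence of `Λ (lᵢ, ωᵢ)` along a filter to a point over the residue field. -/
theorem tendsto_lambdaMap_resMap_iff [IsAlgClosed K] (hR : ¬ IsField R) {F' : Set R}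
    (hF' : Set.SurjOn (IsLocalRing.residue R) F' Set.univ)
    {l₀ : AffineLine (IsLocalRing.ResidueField R) (trivialAbs (IsLocalRing.ResidueField R))} :
    Tendsto (fun i => lambdaMap e he (x i)) f (𝓝 (resMap e he l₀)) ↔
      Tendsto (fun i => ((x i).2 : ℝ)) f atTop ∧
      ((∃ τ₁ : ℝ≥0, τ₁ < 1 ∧ ∃ b : R,
          Tendsto (fun i => lambdaMap e he (x i) (X - C b)) f (𝓝 (τ₁ : ℝ)) ∧
          l₀ = zetaRes R (IsLocalRing.residue R b) τ₁) ∨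
        (∃ τ₂ : ℝ≥0, 1 < τ₂ ∧
          Tendsto (fun i => lambdaMap e he (x i) X) f (𝓝 (τ₂ : ℝ)) ∧ l₀ = zetaRes R 0 τ₂) ∨
        ((∀ c ∈ F', Tendsto (fun i => lambdaMap e he (x i) (X - C c)) f (𝓝 1)) ∧
          l₀ = zetaRes R 0 1)) := by
  constructor
  · intro h
    have hX : ∀ a : R, Tendsto (fun i => lambdaMap e he (x i) (X - C a)) f
        (𝓝 (l₀ (X - C (IsLocalRing.residue R a)))) := fun a => by
      have := AffineLine.tendsto_nhds_iff.1 h (X - C a)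
      rwa [resMap_apply, Polynomial.map_sub, map_X, map_C] at this
    refine ⟨tendsto_atTop_of_tendsto_lambdaMap hR h, ?_⟩
    rcases eq_zetaRes K l₀ with ⟨τ, hτ, b, rfl⟩ | ⟨τ, hτ, rfl⟩ | rfl
    · refine Or.inl ⟨τ, hτ, b, ?_, rfl⟩
      have := hX b
      rwa [zetaRes_X_sub_C, sub_self, map_zero, max_eq_left τ.coe_nonneg] at this
    · refine Or.inr (Or.inl ⟨τ, hτ, ?_, rfl⟩)
      have := hX 0
      rw [zetaRes_X_sub_C, map_zero (IsLocalRing.residue R), sub_self, AbsoluteValue.map_zero,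
        max_eq_left τ.coe_nonneg] at this
      simpa using this
    · refine Or.inr (Or.inr ⟨fun c _ => ?_, rfl⟩)
      have := hX c
      rwa [zetaRes_X_sub_C, NNReal.coe_one, max_eq_left (trivialAbs_le_one _)] at this
  · rintro ⟨hω, ⟨τ, hτ, b, h, rfl⟩ | ⟨τ, hτ, h, rfl⟩ | ⟨h, rfl⟩⟩
    · exact tendsto_lambdaMap_zetaRes_of_lt_one hτ hω h
    · exact tendsto_lambdaMap_zetaRes_of_one_lt hτ hω h
    · exact tendsto_lambdaMap_zetaRes_one hF' hω h

end Convergence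

end BerkovichLine

theorem mainTheorem1 {R : Type*} {K : Type*} [CommRing R] [IsDomain R] [ValuationRing R]
    [Field K] [Algebra R K] [IsFractionRing R K] [IsAlgClosed K]
    (hR : ¬ IsField R)
    (e : ValuationRing.ValueGroup R K →*₀ ℝ≥0) (he : StrictMono e)
    (hcomplete : CauSeq.IsComplete R (BerkovichLine.ringAbs e he))
    (F' : Set R) (hF' : Set.BijOn (IsLocalRing.residue R) F' Set.univ) (h0 : (0 : R) ∈ F') :
    -- (a) the space of the residue field is (canonically) a closed subspace
    IsClosedEmbedding (BerkovichLine.resMap e he) ∧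
    -- (b) `Λ` is a homeomorphism onto the union of the images of the maps `J_ω`
    (IsEmbedding (BerkovichLine.lambdaMap e he) ∧
      Set.range (BerkovichLine.lambdaMap e he) =
        ⋃ ω : Set.Ici (1 : ℝ), Set.range (BerkovichLine.powMap e he ω)) ∧
    -- (c) convergence of nets to points of the space of the residue field
    (∀ (ι : Type*) [Preorder ι] [IsDirectedOrder ι] [Nonempty ι]
      (l : ι → BerkovichLine.AffineLine K (BerkovichLine.fieldAbs e he))
      (ω : ι → Set.Ici (1 : ℝ))
      (l₀ : BerkovichLine.AffineLine (IsLocalRing.ResidueField R)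
        (BerkovichLine.trivialAbs (IsLocalRing.ResidueField R))),
      Tendsto (fun i => BerkovichLine.lambdaMap e he (l i, ω i)) atTop
          (𝓝 (BerkovichLine.resMap e he l₀)) ↔
        Tendsto (fun i => (ω i : ℝ)) atTop atTop ∧
        ((∃ τ₁ : ℝ≥0, τ₁ < 1 ∧ ∃ b : R,
            Tendsto (fun i => l i (X - C (algebraMap R K b)) ^ (ω i : ℝ)) atTop (𝓝 (τ₁ : ℝ)) ∧
            l₀ = BerkovichLine.zetaRes R (IsLocalRing.residue R b) τ₁) ∨
          (∃ τ₂ : ℝ≥0, 1 < τ₂ ∧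
            Tendsto (fun i => l i X ^ (ω i : ℝ)) atTop (𝓝 (τ₂ : ℝ)) ∧
            l₀ = BerkovichLine.zetaRes R 0 τ₂) ∨
          ((∀ c ∈ F',
            Tendsto (fun i => l i (X - C (algebraMap R K c)) ^ (ω i : ℝ)) atTop (𝓝 1)) ∧
            l₀ = BerkovichLine.zetaRes R 0 1))) ∧
    -- (d) the image of `Λ` is open and dense, and the image of `K × (1, ∞)` is dense
    (IsOpen (Set.range (BerkovichLine.lambdaMap e he)) ∧
      DenseRange (BerkovichLine.lambdaMap e he) ∧
      Dense (BerkovichLine.lambdaMap e he ''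
        (Set.range (fun r : K => BerkovichLine.zetaField e he r 0) ×ˢ {ω : Set.Ici (1 : ℝ) | (1 : ℝ) < ω}))) := by
  refine ⟨BerkovichLine.isClosedEmbedding_resMap,
    ⟨BerkovichLine.isEmbedding_lambdaMap hR, BerkovichLine.range_lambdaMap_eq_iUnion hR⟩, ?_,
    BerkovichLine.isOpen_range_lambdaMap hR, BerkovichLine.denseRange_lambdaMap, ?_⟩
  · intro ι _ _ _ l ω l₀
    simpa only [BerkovichLine.lambdaMap_apply, Polynomial.map_sub, map_X, map_C] using
      BerkovichLine.tendsto_lambdaMap_resMap_iff (f := atTop) (x := fun i => (l i, ω i)) hR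
        hF'.surjOn (l₀ := l₀)
  · exact BerkovichLine.denseRange_lambdaMap.dense_image BerkovichLine.continuous_lambdaMap
      ((BerkovichLine.dense_range_zetaField e he hR).prod BerkovichLine.dense_one_lt)
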